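/- Let $(X,d)$ be a metric space with the Besicovitch property: there is an integer $C$ such that from every collection of balls of bounded radii one can extract $C$ countable families of pairwise disjoint balls whose union contains the centres of all balls of the collection. Let $E$ be a separable real Banach space with dual $E'$, and let $\kappa$ be any map assigning to each open ball $\mathsf B(x,r)$ ($x\in X$, $r>0$; a ball is given with its centre and radius) an element $\kappa(\mathsf B(x,r))\in E'$. For $q\in E$, $t\in\mathbb R$, $\delta>0$ and $A\subset X$ put $$\overline{\mathscr P}^{q,t}_{\kappa,\delta}(A)=\sup\Big\{\sum_j r_j^t e^{-\langle q,\kappa(\mathsf B_j)\rangle}\Big\},\qquad \overline{\mathscr H}^{q,t}_{\kappa,\delta}(A)=\inf\Big\{\sum_j r_j^t e^{-\langle q,\kappa(\mathsf B_j)\rangle}\Big\},$$ where the supremum is over all collections $\{\mathsf B_j\}$ of pairwise disjoint balls $\mathsf B_j=\mathsf B(x_j,r_j)$ with $x_j\in A$ and $r_j\le\delta$, and the infimum is over all collections of balls $\mathsf B_j=\mathsf B(x_j,r_j)$ with $x_j\in A$ and $r_j\le\delta$ that cover $A$. Put $$\overline{\mathscr P}^{q,t}_\kappa(A)=\lim_{\delta\searrow0}\overline{\mathscr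 P}^{q,t}_{\kappa,\delta}(A),\qquad \mathscr P^{q,t}_\kappa(A)=\inf\Big\{\sum_{j\in\mathbb N}\overline{\mathscr P}^{q,t}_\kappa(A_j)\;;\;A\subset\bigcup_{j\in\mathbb N} A_j\Big\},$$ $$\overline{\mathscr H}^{q,t}_\kappa(A)=\lim_{\delta\searrow0}\overline{\mathscr H}^{q,t}_{\kappa,\delta}(A),\qquad \mathscr H^{q,t}_\kappa(A)=\sup\big\{\overline{\mathscr H}^{q,t}_\kappa(F)\;;\;F\subset A\big\},$$ and let $B(q)=\inf\{t\in\mathbb R\;;\;\mathscr P^{q,t}_\kappa(X)=0\}\in[-\infty,+\infty]$. **Theorem.** Assume that at some point $q\in E$ the function $B$ is finite in a neighbourhood of $q$ and (Fréchet) differentiable at $q$ with derivative $B'(q)\in E'$, and that $\mathscr H^{q,B(q)}_\kappa(X)>0$. Then $$\dim_H\Big\{x\in X\;;\;\forall v\in E,\ \lim_{r\searrow0}\frac{\langle v,\kappa(\mathsf B(x,r))\rangle}{-\log r}=-B'(q)v\Big\}=B(q)-B'(q)q,$$ where $\dim_H$ denotes Hausdorff dimension. -/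

import Mathlib

open Set Filter Topology
open scoped ENNReal

/-! Balls are recorded as pairs `p : X × ℝ` (centre `p.1`, radius `p.2 > 0`), standing for the
open ball `Metric.ball p.1 p.2`. -/

/-- The Besicovitch property: there is a constant `C` such that from every collection of balls of
bounded radii one can extract `C` countable families of pairwise disjoint balls whose union
contains all the centres of the collection. -/
def BesicovitchProperty (X : Type*) [MetricSpace X] : Prop :=
  ∃ C : ℕ, ∀ 𝓑 : Set (X × ℝ), (∀ p ∈ 𝓑, 0 < p.2) → (∃ R : ℝ, ∀ p ∈ 𝓑, p.2 ≤ R) →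
    ∃ F : Fin C → Set (X × ℝ),
      (∀ j, F j ⊆ 𝓑 ∧ (F j).Countable ∧
        (F j).PairwiseDisjoint (fun p => Metric.ball p.1 p.2)) ∧
      ∀ p ∈ 𝓑, p.1 ∈ ⋃ j, ⋃ b ∈ F j, Metric.ball b.1 b.2

/-- A `δ`-packing of `A`: a collection of disjoint balls of radii at most `δ` centred in `A`. -/
def IsDeltaPacking {X : Type*} [MetricSpace X] (δ : ℝ) (A : Set X) (𝓑 : Set (X × ℝ)) : Prop :=
  (∀ p ∈ 𝓑, p.1 ∈ A ∧ 0 < p.2 ∧ p.2 ≤ δ) ∧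
    𝓑.PairwiseDisjoint (fun p => Metric.ball p.1 p.2)

/-- A centred `δ`-cover of `A`: a collection of balls of radii at most `δ`, centred in `A`,
whose union contains `A`. -/
def IsCenteredDeltaCover {X : Type*} [MetricSpace X] (δ : ℝ) (A : Set X)
    (𝓑 : Set (X × ℝ)) : Prop :=
  (∀ p ∈ 𝓑, p.1 ∈ A ∧ 0 < p.2 ∧ p.2 ≤ δ) ∧ A ⊆ ⋃ p ∈ 𝓑, Metric.ball p.1 p.2

noncomputable section

section VectorOlsen

variable {X : Type*} [MetricSpace X] {E : Type*} [NormedAddCommGroup E] [NormedSpace ℝ E]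

/-- The weight `r ^ t * exp (-⟨q, κ(B)⟩)` of the ball `B = B(x, r)`, where `p = (x, r)`. -/
def ballWeight (κ : X → ℝ → StrongDual ℝ E) (q : E) (t : ℝ) (p : X × ℝ) : ℝ≥0∞ :=
  ENNReal.ofReal (p.2 ^ t * Real.exp (-(κ p.1 p.2 q)))

/-- Supremum of the total weight over all `δ`-packings of `A`. -/
def packingPreDelta (κ : X → ℝ → StrongDual ℝ E) (q : E) (t δ : ℝ) (A : Set X) : ℝ≥0∞ :=
  ⨆ (𝓑 : Set (X × ℝ)) (_ : IsDeltaPacking δ A 𝓑), ∑' p : 𝓑, ballWeight κ q t p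

/-- The packing premeasure: the limit of `packingPreDelta` as `δ` decreases to `0`, which is an
infimum because `packingPreDelta` is nondecreasing in `δ`. -/
def packingPre (κ : X → ℝ → StrongDual ℝ E) (q : E) (t : ℝ) (A : Set X) : ℝ≥0∞ :=
  ⨅ (δ : ℝ) (_ : 0 < δ), packingPreDelta κ q t δ A

/-- The multifractal packing measure. -/
def multifractalPacking (κ : X → ℝ → StrongDual ℝ E) (q : E) (t : ℝ) (A : Set X) : ℝ≥0∞ :=
  ⨅ (s : ℕ → Set X) (_ : A ⊆ ⋃ j, s j), ∑' j, packingPre κ q t (s j)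

/-- Infimum of the total weight over all centred `δ`-covers of `A` (all weights are positive, so
uncountable covers have infinite total weight and do not matter). -/
def hausdorffPreDelta (κ : X → ℝ → StrongDual ℝ E) (q : E) (t δ : ℝ) (A : Set X) : ℝ≥0∞ :=
  ⨅ (𝓑 : Set (X × ℝ)) (_ : IsCenteredDeltaCover δ A 𝓑), ∑' p : 𝓑, ballWeight κ q t p

/-- The centred Hausdorff premeasure: the limit of `hausdorffPreDelta` as `δ` decreases to `0`,
which is a supremum because `hausdorffPreDelta` is nonincreasing in `δ`. -/
def hausdorffPre (κ : X → ℝ → StrongDual ℝ E) (q : E) (t : ℝ) (A : Set X) : ℝ≥0∞ :=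
  ⨆ (δ : ℝ) (_ : 0 < δ), hausdorffPreDelta κ q t δ A

/-- The multifractal centred Hausdorff measure. -/
def multifractalHausdorff (κ : X → ℝ → StrongDual ℝ E) (q : E) (t : ℝ) (A : Set X) : ℝ≥0∞ :=
  ⨆ (F : Set X) (_ : F ⊆ A), hausdorffPre κ q t F

/-- The vector Olsen function `B(q) = inf {t ∈ ℝ : 𝒫^{q,t}(X) = 0}`, with values in `[-∞, ∞]`. -/
def olsenB (κ : X → ℝ → StrongDual ℝ E) (q : E) : EReal :=
  sInf ((fun t : ℝ => (t : EReal)) '' {t : ℝ | multifractalPacking κ q t univ = 0})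

end VectorOlsen

end

/-! With `L = -log r`, the weight of a ball at `(q, t)` is `exp (-L * (t + κ(q) / L))`, so
inequalities between weights encode bounds on the local exponent `κ(v) / L`. The Besicovitch
property turns them into measure estimates: if small balls with weight at `(q, t)` at most that at
`(q', t')` occur at every point of `F`, and the packing measure at `(q', t')` vanishes, then `F` is
null for the centred Hausdorff premeasure at `(q, t)`.

Take `q' = q - s • v` with small `s > 0`. Differentiability of `B` makes points whose upper exponent
along `v` exceeds `-B' v` null at `(q, B(q))`; using `±v` gives the limit off a null set. A
countable dense set of directions and the uniform boundedness principle extend it to all directions,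
so the level set has positive mass.

On the level set the weight at `(q, t)` is `r ^ (t - B' q + o(1))`. Comparison with `r ^ s` gives
both dimension bounds: the upper through packings with `t > B(q)`, the lower from positive mass with
`t = B(q)`. -/

section BallWeight

variable {X : Type*} {E : Type*} [NormedAddCommGroup E] [NormedSpace ℝ E]
  {κ : X → ℝ → StrongDual ℝ E} {q q' : E} {t t' : ℝ}

theorem ballWeight_eq_exp {x : X} {r : ℝ} (hr : 0 < r) :
    ballWeight κ q t (x, r) = ENNReal.ofReal (Real.exp (t * Real.log r - κ x r q)) := by
  rw [ballWeight, Real.rpow_def_of_pos hr, ← Real.exp_add]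
  congr 2
  ring

theorem ballWeight_le_ballWeight {x : X} {r : ℝ} (hr : 0 < r)
    (h : t * Real.log r - κ x r q ≤ t' * Real.log r - κ x r q') :
    ballWeight κ q t (x, r) ≤ ballWeight κ q' t' (x, r) := by
  rw [ballWeight_eq_exp hr, ballWeight_eq_exp hr]
  exact ENNReal.ofReal_le_ofReal (Real.exp_le_exp.2 h)

theorem ballWeight_pos {x : X} {r : ℝ} (hr : 0 < r) : 0 < ballWeight κ q t (x, r) := by
  rw [ballWeight_eq_exp hr]
  exact ENNReal.ofReal_pos.2 (Real.exp_pos _)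

theorem ballWeight_zero (p : X × ℝ) : ballWeight κ 0 t p = ENNReal.ofReal (p.2 ^ t) := by
  simp [ballWeight]

end BallWeight

section HausdorffAndPacking

variable {X : Type*} [MetricSpace X] {E : Type*} [NormedAddCommGroup E] [NormedSpace ℝ E]
  {κ : X → ℝ → StrongDual ℝ E} {q q' : E} {t t' δ δ' : ℝ} {A F : Set X}

/-! ### The packing measure -/

theorem IsDeltaPacking.mono {𝓑 : Set (X × ℝ)} (h : IsDeltaPacking δ A 𝓑) (hδ : δ ≤ δ')
    (hA : A ⊆ F) : IsDeltaPacking δ' F 𝓑 :=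
  ⟨fun p hp => ⟨hA (h.1 p hp).1, (h.1 p hp).2.1, (h.1 p hp).2.2.trans hδ⟩, h.2⟩

theorem packingPreDelta_mono (hδ : δ ≤ δ') (hA : A ⊆ F) :
    packingPreDelta κ q t δ A ≤ packingPreDelta κ q t δ' F :=
  iSup₂_le fun 𝓑 h𝓑 => le_iSup₂_of_le 𝓑 (h𝓑.mono hδ hA) le_rfl

theorem packingPre_mono (hA : A ⊆ F) : packingPre κ q t A ≤ packingPre κ q t F :=
  iInf₂_mono fun _ _ => packingPreDelta_mono le_rfl hA

theorem packingPre_anti_exponent (h : t ≤ t') : packingPre κ q t' A ≤ packingPre κ q t A := by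
  refine le_iInf₂ fun δ hδ => ?_
  -- Radii at most `1` make `log r ≤ 0`, so raising the exponent lowers the weight.
  refine (iInf₂_le (min δ 1) (lt_min hδ one_pos)).trans ?_
  refine iSup₂_le fun 𝓑 h𝓑 => ?_
  refine le_iSup₂_of_le 𝓑 (h𝓑.mono (min_le_left _ _) subset_rfl) ?_
  refine ENNReal.tsum_le_tsum fun ⟨p, hp⟩ => ?_
  obtain ⟨-, h0, h1⟩ := h𝓑.1 p hp
  have hlog : Real.log p.2 ≤ 0 := Real.log_nonpos h0.le (h1.trans (min_le_right _ _))
  exact ballWeight_le_ballWeight h0 (by nlinarith)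

theorem multifractalPacking_anti_exponent (h : t ≤ t') :
    multifractalPacking κ q t' A ≤ multifractalPacking κ q t A :=
  iInf₂_mono fun _ _ => ENNReal.tsum_le_tsum fun _ => packingPre_anti_exponent h

theorem multifractalPacking_eq_zero_of_olsenB_lt (h : olsenB κ q < t) :
    multifractalPacking κ q t univ = 0 := by
  obtain ⟨_, ⟨s, hs, rfl⟩, hst⟩ := sInf_lt_iff.1 h
  exact le_antisymm ((multifractalPacking_anti_exponent (EReal.coe_lt_coe_iff.1 hst).le).trans
    (le_of_eq hs)) zero_le

/-- A single ball is a packing, so its weight is bounded by the packing premeasure. -/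
theorem exists_forall_ballWeight_lt_one (h : packingPre κ q t A < 1) :
    ∃ δ > 0, ∀ x ∈ A, ∀ r, 0 < r → r ≤ δ → ballWeight κ q t (x, r) < 1 := by
  simp only [packingPre, iInf_lt_iff] at h
  obtain ⟨δ, hδ, h⟩ := h
  refine ⟨δ, hδ, fun x hx r hr hrδ => lt_of_le_of_lt ?_ h⟩
  have hp : IsDeltaPacking δ A {(x, r)} :=
    ⟨by rintro p rfl; exact ⟨hx, hr, hrδ⟩, pairwiseDisjoint_singleton _ _⟩
  refine le_iSup₂_of_le _ hp ?_
  rw [tsum_singleton (x, r) (ballWeight κ q t)]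

/-- If the packing measure of exponent `t` vanishes then, at every point,
`-⟨q, κ(B(x, r))⟩ ≤ t * (-log r)` for all small radii. -/
theorem eventually_le_of_multifractalPacking_eq_zero (h : multifractalPacking κ q t univ = 0)
    (x : X) : ∀ᶠ r in 𝓝[>] (0 : ℝ), -κ x r q ≤ t * (-Real.log r) := by
  have h1 : multifractalPacking κ q t univ < 1 := by simp [h]
  simp only [multifractalPacking, iInf_lt_iff] at h1
  obtain ⟨s, hs, hlt⟩ := h1
  obtain ⟨j, hj⟩ := mem_iUnion.1 (hs (mem_univ x))
  obtain ⟨δ, hδ, H⟩ := exists_forall_ballWeight_lt_one ((ENNReal.le_tsum j).trans_lt hlt)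
  filter_upwards [Ioc_mem_nhdsGT hδ] with r hr
  have := H x hj r hr.1 hr.2
  rw [ballWeight_eq_exp hr.1, ENNReal.ofReal_lt_one, Real.exp_lt_one_iff] at this
  linarith

/-! ### The centred Hausdorff measure -/

theorem hausdorffPreDelta_le_tsum {𝓑 : Set (X × ℝ)} (h : IsCenteredDeltaCover δ A 𝓑) :
    hausdorffPreDelta κ q t δ A ≤ ∑' p : 𝓑, ballWeight κ q t p :=
  iInf₂_le 𝓑 h

theorem hausdorffPreDelta_anti (h : δ ≤ δ') :
    hausdorffPreDelta κ q t δ' A ≤ hausdorffPreDelta κ q t δ A :=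
  le_iInf₂ fun _ h𝓑 => hausdorffPreDelta_le_tsum
    ⟨fun p hp => ⟨(h𝓑.1 p hp).1, (h𝓑.1 p hp).2.1, (h𝓑.1 p hp).2.2.trans h⟩, h𝓑.2⟩

theorem hausdorffPreDelta_empty : hausdorffPreDelta κ q t δ (∅ : Set X) = 0 :=
  le_antisymm ((hausdorffPreDelta_le_tsum (𝓑 := ∅) ⟨by simp, by simp⟩).trans (by simp)) zero_le

theorem hausdorffPreDelta_le_ballWeight {x : X} {r : ℝ} (hx : x ∈ A) (hr : 0 < r) (hrδ : r ≤ δ)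
    (hA : A ⊆ Metric.ball x r) : hausdorffPreDelta κ q t δ A ≤ ballWeight κ q t (x, r) := by
  refine (hausdorffPreDelta_le_tsum (𝓑 := {(x, r)}) ⟨?_, by simpa using hA⟩).trans ?_
  · rintro p rfl
    exact ⟨hx, hr, hrδ⟩
  · rw [tsum_singleton (x, r) (ballWeight κ q t)]

/-- Covers of the pieces combine into a cover of `A`. Intersecting with `A` keeps the centres in
`A`; centred premeasures need not be monotone in the set. -/
theorem hausdorffPreDelta_le_tsum_inter {s : ℕ → Set X} (hs : A ⊆ ⋃ j, s j) :
    hausdorffPreDelta κ q t δ A ≤ ∑' j, hausdorffPreDelta κ q t δ (A ∩ s j) := by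
  refine ENNReal.le_of_forall_pos_le_add fun ε hε hfin => ?_
  obtain ⟨η, hη, hsum⟩ := ENNReal.exists_pos_sum_of_countable (ENNReal.coe_ne_zero.2 hε.ne') ℕ
  have hex : ∀ j, ∃ 𝓑, IsCenteredDeltaCover δ (A ∩ s j) 𝓑 ∧
      ∑' p : 𝓑, ballWeight κ q t p < hausdorffPreDelta κ q t δ (A ∩ s j) + η j := by
    intro j
    have : hausdorffPreDelta κ q t δ (A ∩ s j) < hausdorffPreDelta κ q t δ (A ∩ s j) + η j :=
      ENNReal.lt_add_right (ENNReal.ne_top_of_tsum_ne_top hfin.ne j)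
        (ENNReal.coe_ne_zero.2 (hη j).ne')
    conv_lhs at this => rw [hausdorffPreDelta]
    simpa only [iInf_lt_iff, exists_prop] using this
  choose 𝓑 h𝓑 hlt using hex
  have hcov : IsCenteredDeltaCover δ A (⋃ j, 𝓑 j) := by
    refine ⟨fun p hp => ?_, fun x hx => ?_⟩
    · obtain ⟨j, hj⟩ := mem_iUnion.1 hp
      have := (h𝓑 j).1 p hj
      exact ⟨this.1.1, this.2⟩
    · obtain ⟨j, hj⟩ := mem_iUnion.1 (hs hx)
      obtain ⟨p, hp, hxp⟩ := mem_iUnion₂.1 ((h𝓑 j).2 ⟨hx, hj⟩)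
      exact mem_iUnion₂.2 ⟨p, mem_iUnion.2 ⟨j, hp⟩, hxp⟩
  calc hausdorffPreDelta κ q t δ A
      ≤ ∑' p : (⋃ j, 𝓑 j : Set (X × ℝ)), ballWeight κ q t p := hausdorffPreDelta_le_tsum hcov
    _ ≤ ∑' j, ∑' p : 𝓑 j, ballWeight κ q t p := ENNReal.tsum_iUnion_le_tsum _ _
    _ ≤ ∑' j, (hausdorffPreDelta κ q t δ (A ∩ s j) + η j) :=
        ENNReal.tsum_le_tsum fun j => (hlt j).le
    _ = ∑' j, hausdorffPreDelta κ q t δ (A ∩ s j) + ∑' j, (η j : ℝ≥0∞) := ENNReal.tsum_add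
    _ ≤ _ := by gcongr

theorem hausdorffPre_le_tsum_inter {s : ℕ → Set X} (hs : A ⊆ ⋃ j, s j) :
    hausdorffPre κ q t A ≤ ∑' j, hausdorffPre κ q t (A ∩ s j) :=
  iSup₂_le fun δ hδ => (hausdorffPreDelta_le_tsum_inter hs).trans <|
    ENNReal.tsum_le_tsum fun _ => le_iSup₂_of_le δ hδ le_rfl

theorem multifractalHausdorff_eq_zero_iff :
    multifractalHausdorff κ q t A = 0 ↔ ∀ F ⊆ A, hausdorffPre κ q t F = 0 := by
  simp [multifractalHausdorff, ENNReal.iSup_eq_zero]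

theorem multifractalHausdorff_empty : multifractalHausdorff κ q t (∅ : Set X) = 0 := by
  refine multifractalHausdorff_eq_zero_iff.2 fun F hF => ?_
  rw [subset_empty_iff.1 hF]
  simp [hausdorffPre, hausdorffPreDelta_empty]

theorem multifractalHausdorff_eq_zero_of_subset_iUnion {s : ℕ → Set X} (hs : A ⊆ ⋃ j, s j)
    (h : ∀ j, multifractalHausdorff κ q t (s j) = 0) : multifractalHausdorff κ q t A = 0 := by
  refine multifractalHausdorff_eq_zero_iff.2 fun F hF => le_antisymm ?_ zero_le
  refine (hausdorffPre_le_tsum_inter (hF.trans hs)).trans_eq ?_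
  simp [fun j => multifractalHausdorff_eq_zero_iff.1 (h j) (F ∩ s j) inter_subset_right]

theorem multifractalHausdorff_mono (h : A ⊆ F) :
    multifractalHausdorff κ q t A ≤ multifractalHausdorff κ q t F :=
  iSup₂_le fun G hG => le_iSup₂_of_le G (hG.trans h) le_rfl

theorem multifractalHausdorff_biUnion_eq_zero {ι : Type*} {I : Set ι} (hI : I.Countable)
    {s : ι → Set X} (h : ∀ i ∈ I, multifractalHausdorff κ q t (s i) = 0) :
    multifractalHausdorff κ q t (⋃ i ∈ I, s i) = 0 := by
  rcases I.eq_empty_or_nonempty with rfl | hne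
  · simp [multifractalHausdorff_empty]
  · obtain ⟨f, rfl⟩ := hI.exists_eq_range hne
    refine multifractalHausdorff_eq_zero_of_subset_iUnion (s := fun n => s (f n)) (by simp)
      fun n => h _ (mem_range_self n)

theorem multifractalHausdorff_union_eq_zero (hA : multifractalHausdorff κ q t A = 0)
    (hF : multifractalHausdorff κ q t F = 0) : multifractalHausdorff κ q t (A ∪ F) = 0 := by
  refine multifractalHausdorff_eq_zero_of_subset_iUnion (s := fun n => if n = 0 then A else F)
    (union_subset (fun x hx => mem_iUnion.2 ⟨0, by simpa using hx⟩)
      fun x hx => mem_iUnion.2 ⟨1, by simpa using hx⟩) fun n => ?_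
  split_ifs <;> assumption

/-! ### Comparison of Hausdorff and packing measures -/

/-- The balls satisfying the weight inequality are centred at every point of `F`. The Besicovitch
property extracts from them a cover made of boundedly many packings. -/
theorem exists_hausdorffPre_le_mul_packingPre (hX : BesicovitchProperty X) :
    ∃ C : ℕ, ∀ (κ : X → ℝ → StrongDual ℝ E) (q q' : E) (t t' : ℝ) (F : Set X),
      (∀ x ∈ F, ∃ᶠ r in 𝓝[>] (0 : ℝ), ballWeight κ q t (x, r) ≤ ballWeight κ q' t' (x, r)) →
      hausdorffPre κ q t F ≤ C * packingPre κ q' t' F := by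
  obtain ⟨C, hC⟩ := hX
  -- A nonzero constant is needed to move multiplication inside the infimum.
  refine ⟨C + 1, fun κ q q' t t' F h => iSup₂_le fun δ₀ hδ₀ => ?_⟩
  simp only [packingPre, ENNReal.mul_iInf_of_ne (Nat.cast_ne_zero.2 C.succ_ne_zero)
    (ENNReal.natCast_ne_top _)]
  refine le_iInf₂ fun δ₁ hδ₁ => ?_
  set δ := min δ₀ δ₁
  have hδ : 0 < δ := lt_min hδ₀ hδ₁
  obtain ⟨G, hG, hcov⟩ := hC {p | p.1 ∈ F ∧ 0 < p.2 ∧ p.2 ≤ δ ∧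
    ballWeight κ q t p ≤ ballWeight κ q' t' p} (fun p hp => hp.2.1) ⟨δ, fun p hp => hp.2.2.1⟩
  have hcover : IsCenteredDeltaCover δ₀ F (⋃ j, G j) := by
    refine ⟨fun p hp => ?_, fun x hx => ?_⟩
    · obtain ⟨j, hj⟩ := mem_iUnion.1 hp
      have := (hG j).1 hj
      exact ⟨this.1, this.2.1, this.2.2.1.trans (min_le_left _ _)⟩
    · obtain ⟨r, hr, hrδ⟩ := ((h x hx).and_eventually (Ioc_mem_nhdsGT hδ)).exists
      have := hcov (x, r) ⟨hx, hrδ.1, hrδ.2, hr⟩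
      simp only [mem_iUnion] at this ⊢
      obtain ⟨j, p, hp, hxp⟩ := this
      exact ⟨p, ⟨j, hp⟩, hxp⟩
  calc hausdorffPreDelta κ q t δ₀ F
      ≤ ∑' p : (⋃ j, G j : Set (X × ℝ)), ballWeight κ q t p := hausdorffPreDelta_le_tsum hcover
    _ ≤ ∑ j, ∑' p : G j, ballWeight κ q t p := ENNReal.tsum_iUnion_le _ _
    _ ≤ ∑ _j : Fin C, packingPreDelta κ q' t' δ₁ F := by
        refine Finset.sum_le_sum fun j _ => ?_
        refine le_trans (ENNReal.tsum_le_tsum fun p => ((hG j).1 p.2).2.2.2) ?_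
        refine le_iSup₂_of_le (G j) ⟨fun p hp => ?_, (hG j).2.2⟩ le_rfl
        have := (hG j).1 hp
        exact ⟨this.1, this.2.1, this.2.2.1.trans (min_le_right _ _)⟩
    _ = C * packingPreDelta κ q' t' δ₁ F := by simp
    _ ≤ _ := by gcongr; simp

theorem hausdorffPre_eq_zero_of_multifractalPacking_eq_zero (hX : BesicovitchProperty X)
    (hP : multifractalPacking κ q' t' univ = 0)
    (h : ∀ x ∈ F, ∃ᶠ r in 𝓝[>] (0 : ℝ), ballWeight κ q t (x, r) ≤ ballWeight κ q' t' (x, r)) :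
    hausdorffPre κ q t F = 0 := by
  obtain ⟨C, hC⟩ := exists_hausdorffPre_le_mul_packingPre (E := E) hX
  have key : ∀ s : ℕ → Set X, univ ⊆ ⋃ j, s j →
      hausdorffPre κ q t F ≤ (C + 1 : ℕ) * ∑' j, packingPre κ q' t' (s j) := by
    intro s hs
    rw [← ENNReal.tsum_mul_left]
    refine (hausdorffPre_le_tsum_inter ((subset_univ F).trans hs)).trans ?_
    refine ENNReal.tsum_le_tsum fun j => ?_
    refine (hC κ q q' t t' _ fun x hx => h x hx.1).trans ?_
    gcongr
    · exact Nat.le_succ C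
    · exact packingPre_mono inter_subset_right
  have : hausdorffPre κ q t F ≤ (C + 1 : ℕ) * multifractalPacking κ q' t' univ := by
    simp only [multifractalPacking, ENNReal.mul_iInf_of_ne (Nat.cast_ne_zero.2 C.succ_ne_zero)
      (ENNReal.natCast_ne_top _)]
    exact le_iInf₂ key
  simpa [hP] using this

/-! ### Comparison with the ordinary Hausdorff measure -/

open MeasureTheory Metric in
theorem hausdorffMeasure_eq_zero_of_hausdorffPre_eq_zero [MeasurableSpace X] [BorelSpace X]
    {s : ℝ} (hs : 0 ≤ s) (h : hausdorffPre κ 0 s F = 0) : μH[s] F = 0 := by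
  have key : ∀ ε : NNReal, 0 < ε → μH[s] F ≤ 2 ^ s * ε := by
    intro ε hε
    have hex : ∀ n : ℕ, ∃ 𝓑, IsCenteredDeltaCover (1 / (n + 1 : ℝ)) F 𝓑 ∧
        ∑' p : 𝓑, ballWeight κ 0 s p < ε := by
      intro n
      have hn : (0 : ℝ) < 1 / (n + 1) := by positivity
      have : hausdorffPreDelta κ 0 s (1 / (n + 1 : ℝ)) F < ε := by
        refine lt_of_le_of_lt ?_ (ENNReal.coe_pos.2 hε)
        exact (le_iSup₂_of_le (1 / (n + 1 : ℝ)) hn le_rfl).trans h.le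
      simpa only [hausdorffPreDelta, iInf_lt_iff, exists_prop] using this
    choose 𝓑 h𝓑 hlt using hex
    -- All weights are positive and their sum is finite.
    have hcount : ∀ n, Countable (𝓑 n) := by
      intro n
      have := Summable.countable_support_ennreal ((hlt n).trans ENNReal.coe_lt_top).ne
      rwa [Function.support_eq_univ fun p : 𝓑 n => (ballWeight_pos ((h𝓑 n).1 p p.2).2.1).ne',
        countable_univ_iff] at this
    have hdiam : ∀ (n : ℕ) (p : 𝓑 n), ediam (ball p.1.1 p.1.2) ≤ 2 * ENNReal.ofReal p.1.2 := by
      intro n p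
      rw [← eball_ofReal]
      exact ediam_eball_le
    have hr : Tendsto (fun n : ℕ => 2 * ENNReal.ofReal (1 / (n + 1 : ℝ))) atTop (𝓝 0) := by
      have h1 := ENNReal.tendsto_ofReal tendsto_one_div_add_atTop_nhds_zero_nat
      simpa using ENNReal.Tendsto.const_mul h1 (Or.inr ENNReal.ofNat_ne_top)
    refine (Measure.hausdorffMeasure_le_liminf_tsum (ι := fun n => 𝓑 n) s F _ hr
      (fun n p => ball p.1.1 p.1.2) (Eventually.of_forall fun n p => ?_)
      (Eventually.of_forall fun n => ?_)).trans ?_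
    · refine (hdiam n p).trans ?_
      gcongr
      exact ((h𝓑 n).1 p p.2).2.2
    · simpa only [iUnion_subtype] using (h𝓑 n).2
    · refine liminf_le_of_le (by isBoundedDefault) fun b hb => ?_
      obtain ⟨n, hn⟩ := hb.exists
      refine hn.trans ?_
      calc ∑' p : 𝓑 n, ediam (ball p.1.1 p.1.2) ^ s
          ≤ ∑' p : 𝓑 n, 2 ^ s * ballWeight κ 0 s p := by
            refine ENNReal.tsum_le_tsum fun p => ?_
            have hp : 0 < p.1.2 := ((h𝓑 n).1 p p.2).2.1
            rw [ballWeight_zero, ← ENNReal.ofReal_rpow_of_pos hp,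
              ← ENNReal.mul_rpow_of_nonneg _ _ hs]
            exact ENNReal.rpow_le_rpow (hdiam n p) hs
        _ = 2 ^ s * ∑' p : 𝓑 n, ballWeight κ 0 s p := ENNReal.tsum_mul_left
        _ ≤ 2 ^ s * ε := by gcongr; exact (hlt n).le
  have hne : (2 : ℝ≥0∞) ^ s ≠ ⊤ := ENNReal.rpow_ne_top_of_nonneg hs ENNReal.ofNat_ne_top
  have hlim : Tendsto (fun n : ℕ => (2 : ℝ≥0∞) ^ s * ((1 / (n + 1) : NNReal) : ℝ≥0∞)) atTop
      (𝓝 (2 ^ s * 0)) := by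
    refine ENNReal.Tendsto.const_mul ?_ (Or.inr hne)
    exact ENNReal.tendsto_coe.2 tendsto_one_div_add_atTop_nhds_zero_nat
  rw [mul_zero] at hlim
  exact le_antisymm (ge_of_tendsto' hlim fun n => key _ (by positivity)) zero_le

-- A set lies in an open ball about any of its points with radius just above its diameter. Letting
-- the radius decrease to the diameter loses no constant and also handles diameter `0`.
open Metric in
theorem hausdorffPreDelta_zero_le_ediam_rpow {s : ℝ} {G : Set X}
    (hG : ediam G < ENNReal.ofReal δ) :
    hausdorffPreDelta κ 0 s δ G ≤ ⨆ _ : G.Nonempty, ediam G ^ s := by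
  rcases G.eq_empty_or_nonempty with rfl | hne
  · simp [hausdorffPreDelta_empty]
  obtain ⟨x, hx⟩ := hne
  have hd : ediam G ≠ ⊤ := hG.ne_top
  have hdδ : diam G < δ := (ENNReal.lt_ofReal_iff_toReal_lt hd).1 hG
  simp only [show G.Nonempty from ⟨x, hx⟩, iSup_pos]
  have hlim : Tendsto (fun r : ℝ => ENNReal.ofReal r ^ s) (𝓝[>] (diam G)) (𝓝 (ediam G ^ s)) := by
    have h1 : Tendsto (fun r : ℝ => ENNReal.ofReal r) (𝓝 (diam G)) (𝓝 (ediam G)) := by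
      simpa [diam, ENNReal.ofReal_toReal hd] using
        ENNReal.continuous_ofReal.tendsto (diam G)
    exact ((ENNReal.continuous_rpow_const.tendsto _).comp h1).mono_left nhdsWithin_le_nhds
  refine ge_of_tendsto hlim ?_
  filter_upwards [Ioc_mem_nhdsGT hdδ] with r hr
  have hr0 : 0 < r := diam_nonneg.trans_lt hr.1
  refine (hausdorffPreDelta_le_ballWeight hx hr0 hr.2 fun y hy => ?_).trans ?_
  · exact (dist_le_diam_of_mem (isBounded_iff_ediam_ne_top.2 hd) hy hx).trans_lt hr.1
  · rw [ballWeight_zero, ENNReal.ofReal_rpow_of_pos hr0]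

open MeasureTheory Metric in
theorem hausdorffPre_zero_le_hausdorffMeasure [MeasurableSpace X] [BorelSpace X] {s : ℝ}
    (hs : 0 < s) : hausdorffPre κ 0 s F ≤ μH[s] F := by
  refine iSup₂_le fun δ hδ => ?_
  rw [Measure.hausdorffMeasure_apply]
  refine le_iSup₂_of_le (ENNReal.ofReal (δ / 2)) (by simpa using hδ) ?_
  refine le_iInf fun T => le_iInf fun hT => le_iInf fun hd => ?_
  refine (hausdorffPreDelta_le_tsum_inter hT).trans (ENNReal.tsum_le_tsum fun n => ?_)
  have hle : ediam (F ∩ T n) ≤ ediam (T n) := ediam_mono inter_subset_right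
  refine (hausdorffPreDelta_zero_le_ediam_rpow ?_).trans ?_
  · refine (hle.trans (hd n)).trans_lt ?_
    rw [ENNReal.ofReal_lt_ofReal_iff hδ]
    linarith
  · refine iSup_le fun hne => le_iSup_of_le (hne.mono inter_subset_right) ?_
    exact ENNReal.rpow_le_rpow hle hs.le

end HausdorffAndPacking

/-! ### Local exponents and the dimension of the level set. -/

section MultifractalAnalysis

variable {X : Type*} [MetricSpace X] {E : Type*} [NormedAddCommGroup E] [NormedSpace ℝ E]
  {κ : X → ℝ → StrongDual ℝ E} {q : E} {B' : StrongDual ℝ E}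

theorem eventually_neg_log_pos : ∀ᶠ r in 𝓝[>] (0 : ℝ), 0 < -Real.log r := by
  filter_upwards [Ioo_mem_nhdsGT one_pos] with r hr
  exact neg_pos.2 (Real.log_neg hr.1 hr.2)

theorem multifractalPacking_eq_zero_of_toReal_lt {p : E} {t : ℝ}
    (hp : olsenB κ p ≠ ⊤ ∧ olsenB κ p ≠ ⊥) (h : (olsenB κ p).toReal < t) :
    multifractalPacking κ p t univ = 0 :=
  multifractalPacking_eq_zero_of_olsenB_lt <| by
    rw [← EReal.coe_toReal hp.1 hp.2]
    exact EReal.coe_lt_coe_iff.2 h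

/-- The points at which the upper local exponent of `κ` in the direction `v` exceeds `-B' v`
form a null set. -/
theorem multifractalHausdorff_setOf_frequently_eq_zero (hX : BesicovitchProperty X)
    (hfin : ∀ᶠ p in 𝓝 q, olsenB κ p ≠ ⊤ ∧ olsenB κ p ≠ ⊥)
    (hdiff : HasFDerivAt (fun p : E => (olsenB κ p).toReal) B' q) (v : E) {α : ℝ}
    (hα : -(B' v) < α) :
    multifractalHausdorff κ q (olsenB κ q).toReal
      {x | ∃ᶠ r in 𝓝[>] (0 : ℝ), α * (-Real.log r) < κ x r v} = 0 := by
  have hline : HasDerivAt (fun s : ℝ => q - s • v) (-v) 0 := by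
    simpa using ((hasDerivAt_id (0 : ℝ)).smul_const v).const_sub q
  have h0 : q - (0 : ℝ) • v = q := by simp
  have hderiv : HasDerivAt (fun s : ℝ => (olsenB κ (q - s • v)).toReal) (-(B' v)) 0 := by
    have := HasFDerivAt.comp_hasDerivAt (0 : ℝ) (h0.symm ▸ hdiff) hline
    simpa using! this
  have hslope := ((hasDerivAt_iff_tendsto_slope.1 hderiv).mono_left
    (nhdsGT_le_nhdsNE 0)).eventually_lt_const hα
  have hfin' : ∀ᶠ s in 𝓝[>] (0 : ℝ), olsenB κ (q - s • v) ≠ ⊤ ∧ olsenB κ (q - s • v) ≠ ⊥ := by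
    have : Tendsto (fun s : ℝ => q - s • v) (𝓝[>] 0) (𝓝 q) := by
      simpa [h0] using hline.continuousAt.tendsto.mono_left nhdsWithin_le_nhds
    exact this.eventually hfin
  -- A step `s` at which the difference quotient along `-v` is below `α`, so `q - s • v` has
  -- vanishing packing measure at exponent `B(q) + s * α`.
  obtain ⟨s, ⟨hs, hsfin⟩, hs0 : 0 < s⟩ := ((hslope.and hfin').and self_mem_nhdsWithin).exists
  have hlt : (olsenB κ (q - s • v)).toReal < (olsenB κ q).toReal + s * α := by
    rw [slope_def_field, h0, sub_zero, div_lt_iff₀ hs0] at hs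
    linarith
  refine multifractalHausdorff_eq_zero_iff.2 fun F hF =>
    hausdorffPre_eq_zero_of_multifractalPacking_eq_zero hX
      (multifractalPacking_eq_zero_of_toReal_lt hsfin hlt) fun x hx => ?_
  refine ((hF hx).and_eventually self_mem_nhdsWithin).mono fun r hr => ?_
  refine ballWeight_le_ballWeight hr.2 ?_
  have := mul_pos hs0 (sub_pos.2 hr.1)
  simp only [map_sub, map_smul, smul_eq_mul]
  linarith

theorem multifractalHausdorff_setOf_not_tendsto_eq_zero (hX : BesicovitchProperty X)
    (hfin : ∀ᶠ p in 𝓝 q, olsenB κ p ≠ ⊤ ∧ olsenB κ p ≠ ⊥)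
    (hdiff : HasFDerivAt (fun p : E => (olsenB κ p).toReal) B' q) (v : E) :
    multifractalHausdorff κ q (olsenB κ q).toReal
      {x | ¬ Tendsto (fun r : ℝ => κ x r v / (-Real.log r)) (𝓝[>] 0) (𝓝 (-(B' v)))} = 0 := by
  have hpos : ∀ n : ℕ, (0 : ℝ) < 1 / (n + 1) := fun n => by positivity
  refine multifractalHausdorff_eq_zero_of_subset_iUnion (fun x hx => ?_) fun n =>
    multifractalHausdorff_union_eq_zero
      (multifractalHausdorff_setOf_frequently_eq_zero hX hfin hdiff v
        (α := -(B' v) + 1 / (n + 1)) (by linarith [hpos n]))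
      (multifractalHausdorff_setOf_frequently_eq_zero hX hfin hdiff (-v)
        (α := B' v + 1 / (n + 1)) (by simpa using hpos n))
  contrapose! hx
  simp only [mem_iUnion, mem_union, mem_ofPred_eq, not_exists, not_or, not_frequently, not_lt,
    not_not] at hx ⊢
  refine Metric.tendsto_nhds.2 fun ε hε => ?_
  obtain ⟨n, hn⟩ := exists_nat_one_div_lt hε
  filter_upwards [(hx n).1, (hx n).2, eventually_neg_log_pos] with r h1 h2 hL
  refine lt_of_le_of_lt ?_ hn
  rw [map_neg] at h2
  rw [Real.dist_eq, abs_le]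
  constructor
  · have : -(B' v) - 1 / (n + 1) ≤ κ x r v / (-Real.log r) := by
      rw [le_div_iff₀ hL]; linarith
    linarith
  · have : κ x r v / (-Real.log r) ≤ -(B' v) + 1 / (n + 1) := by
      rw [div_le_iff₀ hL]; linarith
    linarith

/-- Finiteness of `B` at `q + s • v` bounds `-κ(q + s • v) / L` above through single-ball packings.
The limit along `q` removes the `q` term, leaving a one-sided bound along `v`. -/
theorem exists_eventually_neg_div_le (hfin : ∀ᶠ p in 𝓝 q, olsenB κ p ≠ ⊤ ∧ olsenB κ p ≠ ⊥)
    {x : X} {a : ℝ} (hq : Tendsto (fun r : ℝ => κ x r q / (-Real.log r)) (𝓝[>] 0) (𝓝 a)) (v : E) :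
    ∃ C : ℝ, ∀ᶠ r in 𝓝[>] (0 : ℝ), -(κ x r v / (-Real.log r)) ≤ C := by
  have hfin' : ∀ᶠ s in 𝓝[>] (0 : ℝ), olsenB κ (q + s • v) ≠ ⊤ ∧ olsenB κ (q + s • v) ≠ ⊥ := by
    have : Tendsto (fun s : ℝ => q + s • v) (𝓝[>] 0) (𝓝 (q + (0 : ℝ) • v)) :=
      (Continuous.tendsto (by fun_prop) 0).mono_left nhdsWithin_le_nhds
    rw [zero_smul, add_zero] at this
    exact this.eventually hfin
  obtain ⟨s, hs, hs0 : 0 < s⟩ := (hfin'.and self_mem_nhdsWithin).exists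
  have hP := multifractalPacking_eq_zero_of_toReal_lt hs (lt_add_one _)
  set t := (olsenB κ (q + s • v)).toReal + 1
  refine ⟨(t + (a + 1)) / s, ?_⟩
  filter_upwards [eventually_le_of_multifractalPacking_eq_zero hP x, eventually_neg_log_pos,
    hq.eventually_le_const (lt_add_one a)] with r h1 hL h2
  rw [div_le_iff₀ hL] at h2
  rw [← neg_div, div_le_iff₀ hL, div_mul_eq_mul_div, le_div_iff₀ hs0]
  simp only [map_add, map_smul, smul_eq_mul] at h1
  linarith

/-- A sequence of functionals which is pointwise bounded and converges on a dense set converges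
pointwise. -/
theorem tendsto_apply_of_dense [CompleteSpace E] {g : ℕ → StrongDual ℝ E} {f : StrongDual ℝ E}
    (hb : ∀ v, ∃ C, ∀ n, ‖g n v‖ ≤ C) {D : Set E} (hD : Dense D)
    (h : ∀ v ∈ D, Tendsto (fun n => g n v) atTop (𝓝 (f v))) (v : E) :
    Tendsto (fun n => g n v) atTop (𝓝 (f v)) := by
  obtain ⟨C, hC⟩ := banach_steinhaus hb
  have hC0 : 0 ≤ C := (norm_nonneg _).trans (hC 0)
  refine Metric.tendsto_nhds.2 fun ε hε => ?_
  have hK : 0 < C + ‖f‖ + 1 := by positivity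
  obtain ⟨w, hw, hvw⟩ := hD.exists_dist_lt v (show 0 < ε / 2 / (C + ‖f‖ + 1) by positivity)
  rw [dist_eq_norm, lt_div_iff₀ hK] at hvw
  filter_upwards [Metric.tendsto_nhds.1 (h w hw) (ε / 2) (half_pos hε)] with n hn
  have h1 : ‖g n (v - w)‖ ≤ C * ‖v - w‖ := (g n).le_of_opNorm_le (hC n) _
  have h2 : ‖f (v - w)‖ ≤ ‖f‖ * ‖v - w‖ := f.le_opNorm _
  have h3 : g n v - f v = g n (v - w) - f (v - w) + (g n w - f w) := by
    simp only [map_sub]; ring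
  rw [dist_eq_norm] at hn ⊢
  rw [h3]
  have h4 := norm_add_le (g n (v - w) - f (v - w)) (g n w - f w)
  have h5 := norm_sub_le (g n (v - w)) (f (v - w))
  nlinarith [norm_nonneg (v - w)]

theorem tendsto_div_neg_log_of_dense [CompleteSpace E]
    (hfin : ∀ᶠ p in 𝓝 q, olsenB κ p ≠ ⊤ ∧ olsenB κ p ≠ ⊥) {D : Set E} (hD : Dense D)
    (hqD : q ∈ D) {x : X} {f : StrongDual ℝ E}
    (h : ∀ v ∈ D, Tendsto (fun r : ℝ => κ x r v / (-Real.log r)) (𝓝[>] 0) (𝓝 (f v))) (v : E) :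
    Tendsto (fun r : ℝ => κ x r v / (-Real.log r)) (𝓝[>] 0) (𝓝 (f v)) := by
  -- Along a sequence of radii, eventual bounds become bounds for all indices, as uniform
  -- boundedness requires.
  refine tendsto_of_seq_tendsto fun u hu => ?_
  have key := tendsto_apply_of_dense (g := fun n => (-Real.log (u n))⁻¹ • κ x (u n)) (f := f)
    (fun w => ?_) hD (fun w hw => ?_) v
  · simpa [div_eq_inv_mul] using! key
  · obtain ⟨C₁, hC₁⟩ := exists_eventually_neg_div_le hfin (h q hqD) w
    obtain ⟨C₂, hC₂⟩ := exists_eventually_neg_div_le hfin (h q hqD) (-w)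
    have hbdd : IsBoundedUnder (· ≤ ·) atTop
        fun n => ‖((-Real.log (u n))⁻¹ • κ x (u n)) w‖ := by
      refine ⟨max C₂ C₁, eventually_map.2 ?_⟩
      filter_upwards [hu.eventually hC₁, hu.eventually hC₂] with n h1 h2
      rw [map_neg, neg_div, neg_neg] at h2
      rw [_root_.smul_apply, smul_eq_mul, ← div_eq_inv_mul, Real.norm_eq_abs, abs]
      exact max_le_max h2 h1
    obtain ⟨C, hC⟩ := hbdd.bddAbove_range
    exact ⟨C, fun n => hC (mem_range_self n)⟩
  · simpa [div_eq_inv_mul] using! (h w hw).comp hu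

/-- The level set of the local exponent carries positive mass. -/
theorem multifractalHausdorff_levelSet_pos [CompleteSpace E] [TopologicalSpace.SeparableSpace E]
    (hX : BesicovitchProperty X) (hfin : ∀ᶠ p in 𝓝 q, olsenB κ p ≠ ⊤ ∧ olsenB κ p ≠ ⊥)
    (hdiff : HasFDerivAt (fun p : E => (olsenB κ p).toReal) B' q)
    (hpos : 0 < multifractalHausdorff κ q (olsenB κ q).toReal univ) :
    0 < multifractalHausdorff κ q (olsenB κ q).toReal {x : X | ∀ v : E,
      Tendsto (fun r : ℝ => κ x r v / (-Real.log r)) (𝓝[>] 0) (𝓝 (-(B' v)))} := by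
  obtain ⟨D₀, hD₀, hD₀'⟩ := TopologicalSpace.exists_countable_dense E
  -- The direction `q` is inserted because the pointwise bounds rely on the limit along `q`.
  have hnull := multifractalHausdorff_biUnion_eq_zero (hD₀.insert q) fun v _ =>
    multifractalHausdorff_setOf_not_tendsto_eq_zero hX hfin hdiff v
  by_contra! h
  refine hpos.not_ge (le_trans (multifractalHausdorff_mono fun x _ => ?_)
    (multifractalHausdorff_union_eq_zero (nonpos_iff_eq_zero.1 h) hnull).le)
  by_contra hx
  simp only [mem_union, mem_iUnion, mem_ofPred_eq, not_or, not_exists, not_not] at hx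
  exact hx.1 (tendsto_div_neg_log_of_dense (f := -B') hfin (hD₀'.mono (subset_insert q D₀))
    (mem_insert q D₀) fun v hv => hx.2 v hv)

/-- For `B(q) < t < s + a`, small balls centred in `S` satisfy `r ^ s ≤` their weight at `(q, t)`,
where the packing measure vanishes. -/
theorem dimH_levelSet_le (hX : BesicovitchProperty X)
    (hq : olsenB κ q ≠ ⊤ ∧ olsenB κ q ≠ ⊥) {S : Set X} {a : ℝ}
    (hS : ∀ x ∈ S, Tendsto (fun r : ℝ => κ x r q / (-Real.log r)) (𝓝[>] 0) (𝓝 (-a)))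
    {s : NNReal} (hs : (olsenB κ q).toReal - a < s) : dimH S ≤ s := by
  borelize X
  refine dimH_le_of_hausdorffMeasure_ne_top (ne_of_eq_of_ne ?_ ENNReal.zero_ne_top)
  obtain ⟨t, ht, hts⟩ := exists_between (sub_lt_iff_lt_add.1 hs)
  refine hausdorffMeasure_eq_zero_of_hausdorffPre_eq_zero (κ := κ) s.2 <|
    hausdorffPre_eq_zero_of_multifractalPacking_eq_zero hX
      (multifractalPacking_eq_zero_of_toReal_lt hq ht) fun x hx => ?_
  have hlt : -a < s - t := by linarith
  refine Eventually.frequently ?_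
  filter_upwards [(hS x hx).eventually_le_const hlt, eventually_neg_log_pos,
    self_mem_nhdsWithin] with r hr hL hr0
  rw [div_le_iff₀ hL] at hr
  refine ballWeight_le_ballWeight hr0 ?_
  rw [map_zero]
  linarith

/-- For `s < t - a`, weights at `(q, t)` are eventually at most `r ^ s`, so a null `s`-dimensional
Hausdorff measure would force zero mass. -/
theorem le_dimH_levelSet {t a : ℝ} {S : Set X}
    (hS : ∀ x ∈ S, Tendsto (fun r : ℝ => κ x r q / (-Real.log r)) (𝓝[>] 0) (𝓝 (-a)))
    (hpos : 0 < multifractalHausdorff κ q t S) {s : NNReal} (hs0 : 0 < s) (hs : s < t - a) :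
    s ≤ dimH S := by
  borelize X
  refine le_dimH_of_hausdorffMeasure_ne_zero fun hzero => hpos.ne' ?_
  -- Splitting by the scale below which the comparison holds makes it uniform on each piece; covers
  -- centred in the piece then inherit it.
  refine multifractalHausdorff_eq_zero_of_subset_iUnion (s := fun n : ℕ => {x ∈ S |
    ∀ r, 0 < r → r ≤ 1 / (n + 1 : ℝ) → ballWeight κ q t (x, r) ≤ ballWeight κ 0 s (x, r)})
    (fun x hx => ?_) fun n => ?_
  · have hlt : s - t < -a := by linarith
    have hev : ∀ᶠ r in 𝓝[>] (0 : ℝ), ballWeight κ q t (x, r) ≤ ballWeight κ 0 s (x, r) := by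
      filter_upwards [(hS x hx).eventually_const_le hlt, eventually_neg_log_pos,
        self_mem_nhdsWithin] with r hr hL hr0
      rw [le_div_iff₀ hL] at hr
      refine ballWeight_le_ballWeight hr0 ?_
      rw [map_zero]
      linarith
    obtain ⟨δ, hδ : 0 < δ, hsub⟩ := mem_nhdsGT_iff_exists_Ioo_subset.1 hev
    obtain ⟨n, hn⟩ := exists_nat_one_div_lt hδ
    exact mem_iUnion.2 ⟨n, hx, fun r h0 h1 => hsub ⟨h0, h1.trans_lt hn⟩⟩
  · refine multifractalHausdorff_eq_zero_iff.2 fun F hF => le_antisymm ?_ zero_le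
    have hn : (0 : ℝ) < 1 / (n + 1) := by positivity
    calc hausdorffPre κ q t F
        ≤ hausdorffPre κ 0 s F := by
          refine iSup₂_le fun δ hδ => ?_
          refine (hausdorffPreDelta_anti (min_le_left δ (1 / (n + 1 : ℝ)))).trans ?_
          refine le_iSup₂_of_le _ (lt_min hδ hn) ?_
          refine le_iInf₂ fun 𝓑 h𝓑 => (hausdorffPreDelta_le_tsum h𝓑).trans ?_
          refine ENNReal.tsum_le_tsum fun ⟨p, hp⟩ => ?_
          obtain ⟨hpF, hp0, hp1⟩ := h𝓑.1 p hp
          exact (hF hpF).2 p.2 hp0 (hp1.trans (min_le_right _ _))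
      _ ≤ MeasureTheory.Measure.hausdorffMeasure s F :=
          hausdorffPre_zero_le_hausdorffMeasure (NNReal.coe_pos.2 hs0)
      _ ≤ MeasureTheory.Measure.hausdorffMeasure s S :=
          MeasureTheory.measure_mono fun x hx => (hF hx).1
      _ = 0 := hzero

/-- At a point where the local exponent in the direction `q` is `-a`, single balls force
`B(q) - a ≥ 0`. -/
theorem olsenB_sub_nonneg (hq : olsenB κ q ≠ ⊤ ∧ olsenB κ q ≠ ⊥) {x : X} {a : ℝ}
    (hx : Tendsto (fun r : ℝ => κ x r q / (-Real.log r)) (𝓝[>] 0) (𝓝 (-a))) :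
    0 ≤ (olsenB κ q).toReal - a := by
  refine sub_nonneg.2 (le_of_forall_gt_imp_ge_of_dense fun t ht => ?_)
  have hP := multifractalPacking_eq_zero_of_toReal_lt hq ht
  refine neg_le_neg_iff.1 (ge_of_tendsto hx ?_)
  filter_upwards [eventually_le_of_multifractalPacking_eq_zero hP x, eventually_neg_log_pos]
    with r h1 hL
  rw [le_div_iff₀ hL]
  linarith

theorem dimH_eq_of_forall_nnreal {S : Set X} {d : ℝ} (hd : 0 ≤ d)
    (hle : ∀ s : NNReal, d < s → dimH S ≤ s) (hge : ∀ s : NNReal, 0 < s → s < d → s ≤ dimH S) :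
    ((dimH S : ℝ≥0∞) : EReal) = (d : EReal) := by
  lift d to NNReal using hd
  have : dimH S = d := by
    refine le_antisymm (ENNReal.le_of_forall_nnreal_lt fun r hr => ?_)
      (ENNReal.le_of_forall_nnreal_lt fun r hr => ?_)
    · by_contra! hlt
      obtain ⟨s, hs1, hs2⟩ := exists_between hlt
      lift s to NNReal using hs2.ne_top
      exact (hr.trans_le (hle s (by exact_mod_cast hs1))).not_gt hs2
    · rcases eq_zero_or_pos r with rfl | hr0
      · simp
      · exact hge r hr0 (by exact_mod_cast hr)
  rw [this]
  rfl

end MultifractalAnalysis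

theorem mainTheorem8 {X : Type*} [MetricSpace X] (hX : BesicovitchProperty X)
    {E : Type*} [NormedAddCommGroup E] [NormedSpace ℝ E] [CompleteSpace E]
    [TopologicalSpace.SeparableSpace E]
    (κ : X → ℝ → StrongDual ℝ E) (q : E) (B' : StrongDual ℝ E)
    (hfin : ∀ᶠ p in 𝓝 q, olsenB κ p ≠ ⊤ ∧ olsenB κ p ≠ ⊥)
    (hdiff : HasFDerivAt (fun p : E => (olsenB κ p).toReal) B' q)
    (hpos : 0 < multifractalHausdorff κ q (olsenB κ q).toReal univ) :
    ((dimH {x : X | ∀ v : E,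
        Tendsto (fun r : ℝ => κ x r v / (-Real.log r)) (𝓝[>] 0) (𝓝 (-(B' v)))} : ℝ≥0∞) : EReal)
      = (((olsenB κ q).toReal - B' q : ℝ) : EReal) := by
  have hlevel := multifractalHausdorff_levelSet_pos hX hfin hdiff hpos
  set S := {x : X | ∀ v : E,
    Tendsto (fun r : ℝ => κ x r v / (-Real.log r)) (𝓝[>] 0) (𝓝 (-(B' v)))}
  have hq := hfin.self_of_nhds
  -- A point of `S` is needed for `B(q) - B' q ≥ 0`.
  obtain ⟨x, hx⟩ : S.Nonempty := by
    by_contra! hS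
    rw [hS, multifractalHausdorff_empty] at hlevel
    exact lt_irrefl _ hlevel
  exact dimH_eq_of_forall_nnreal (olsenB_sub_nonneg hq (hx q))
    (fun s hs => dimH_levelSet_le hX hq (S := S) (fun x hx => hx q) hs)
    (fun s hs0 hs => le_dimH_levelSet (S := S) (fun x hx => hx q) hlevel hs0 hs)
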